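/- Let $k$ be an algebraically closed field of characteristic $p>0$, let $n\ge 2$ be an integer with $p\nmid n$, let $\lambda\in k$ be a primitive $n$-th root of unity and let $t_1,\dots,t_d$ be non-negative integers. Let $G\subset \mathrm{GL}(d,k)$ be the cyclic group generated by $g=\mathrm{diag}(\lambda^{t_1},\dots,\lambda^{t_d})$; assume that $G$ has order $n$ and is small (no element of $G$ has a fixed space of dimension $d-1$). Let $G$ act linearly on $S=k[[x_1,\dots,x_d]]$ and let $R=S^G$ be the cyclic quotient singularity $\frac1n(t_1,\dots,t_d)$. The irreducible representations of $G$ over $k$ are the one-dimensional $V_0,\dots,V_{n-1}$, where $g$ acts on $V_\beta$ by $\lambda^\beta$; put $M_\beta=(S\otimes_k V_\beta)^G$. For every $e\in\mathbb N$ there are unique integers $\mathrm{mult}(M_\beta,R^{1/p^e})\ge 0$ with $R^{1/p^e}\cong\bigoplus_{\beta}M_\beta^{\mathrm{mult}(M_\beta,R^{1/p^e})}$ as $R$-modules. For $e\in\mathbb N$ write $p^e=qn+r_e$ with integers $q\ge 0$ and $0<r_e<n$. For $J\subseteq\{1,\dots,d\}$ let $g_J=\gcd(n,\,t_j: j\in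 J)$ (so $g_\emptyset=n$), and for $0\le\alpha\le n-1$ let $\theta_J^{(\alpha)}(e)$ be the number of tuples $(a_l)_{l\notin J}$ of integers with $0\le a_l\le r_e-1$ and $\sum_{l\notin J}a_lt_l\equiv\alpha \pmod{g_J}$ (and $\theta_{\{1,\dots,d\}}^{(\alpha)}(e)=1$). Put $\psi_i^{(\alpha)}(e)=\sum_{|J|=i}g_J\,\theta_J^{(\alpha)}(e)$ and $$\Phi_c^{(\alpha)}(e)=\frac1n\sum_{i=c}^{d}(-1)^{i-c}\binom ic\,\psi_i^{(\alpha)}(e)\,r_e^{\,i-c}\qquad(0\le c\le d).$$ Say that $f:\mathbb N\to\mathbb N$ has quasi-polynomial coefficients $\varphi_0,\dots,\varphi_d$ if the $\varphi_c:\mathbb N\to\mathbb Q$ are periodic functions with $f(e)=\sum_{c=0}^d\varphi_c(e)\,p^{ce}$ for all $e\in\mathbb N$. (1) Let $0\le\alpha\le n-1$, and for every $e$ let $M_{\alpha,e}$ be the module $M_\beta$ for which $g$ acts on $V_\beta$ by $(\lambda^{1/p^e})^{\alpha}$, that is, $p^e\beta\equiv\alpha\pmod n$. Then $e\mapsto\mathrm{mult}(M_{\alpha,e},R^{1/p^e})$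 has quasi-polynomial coefficients, these are unique, and they are $$\varphi_c^{(\alpha)}(e)=\Phi_c^{(\alpha)}(e)=\frac1n\sum_{i=c}^{d}(-1)^{i-c}\binom ic\,\psi_i^{(\alpha)}(e)\,r_e^{\,i-c}.$$ (2) For a fixed module $M_\beta$, $0\le\beta\le n-1$, the function $e\mapsto\mathrm{mult}(M_\beta,R^{1/p^e})$ has unique quasi-polynomial coefficients, and they are $e\mapsto\Phi_c^{(\alpha_e)}(e)$, where $\alpha_e\in\{0,\dots,n-1\}$ is the residue of $p^e\beta$ modulo $n$. For $\alpha=\beta=0$ both say that the F-signature function $\mathrm{mult}(R,R^{1/p^e})$ has coefficients $\Phi_c^{(0)}$. -/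

import Mathlib

open scoped TensorProduct

noncomputable section

namespace QuotientSingularity

universe u

section Invariants

variable {k : Type u} [Field k] {d : ℕ}

/-- The linear forms `g · x_j = ∑ i, g i j • x_i` may be substituted into a power series. -/
theorem hasSubst_linear (g : GL (Fin d) k) :
    MvPowerSeries.HasSubst (fun j : Fin d =>
      (∑ i, (g : Matrix (Fin d) (Fin d) k) i j • MvPowerSeries.X i :
        MvPowerSeries (Fin d) k)) := by
  refine MvPowerSeries.hasSubst_of_constantCoeff_zero (fun j => ?_)
  rw [map_sum]
  refine Finset.sum_eq_zero (fun i _ => ?_)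
  rw [MvPowerSeries.smul_eq_C_mul, map_mul, MvPowerSeries.constantCoeff_X, mul_zero]

/-- The linear action of `g ∈ GL(d, k)` on `S = k⟦x_1, …, x_d⟧`: the continuous `k`-algebra
endomorphism with `x_j ↦ ∑ i, g i j • x_i`. -/
def linearAction (g : GL (Fin d) k) :
    MvPowerSeries (Fin d) k →ₐ[k] MvPowerSeries (Fin d) k :=
  MvPowerSeries.substAlgHom (hasSubst_linear g)

/-- The ring of invariants `R = S^G`. -/
def invariantRing (G : Subgroup (GL (Fin d) k)) : Subalgebra k (MvPowerSeries (Fin d) k) where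
  carrier := {f | ∀ g ∈ G, linearAction g f = f}
  mul_mem' := fun hf hf' g hg => by rw [map_mul, hf g hg, hf' g hg]
  add_mem' := fun hf hf' g hg => by rw [map_add, hf g hg, hf' g hg]
  algebraMap_mem' := fun r g _ => AlgHom.commutes (linearAction g) r

/-- The invariant ring has the characteristic exponent of the ground field. -/
instance invariantRing_expChar (G : Subgroup (GL (Fin d) k)) (p : ℕ) [ExpChar k p] :
    ExpChar (invariantRing G) p :=
  expChar_of_injective_algebraMap (algebraMap k (invariantRing G)).injective p

/-- The module of covariants `(S ⊗ W)^G` of a representation `W` of `G`, an `S^G`-submodule of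
`S ⊗ W`; here `g ∈ G` acts on `S ⊗ W` by `g · (f ⊗ w) = (g · f) ⊗ (g · w)`. -/
def covariants (G : Subgroup (GL (Fin d) k)) {W : Type u} [AddCommGroup W] [Module k W]
    (ρ : Representation k G W) :
    Submodule (invariantRing G) (MvPowerSeries (Fin d) k ⊗[k] W) where
  carrier := {u | ∀ g : G, TensorProduct.map (linearAction (g : GL (Fin d) k)).toLinearMap
    (ρ g) u = u}
  zero_mem' := fun g => map_zero _
  add_mem' := fun hu hv g => by rw [map_add, hu g, hv g]
  smul_mem' := fun r u hu g => by
    have key : ∀ w : MvPowerSeries (Fin d) k ⊗[k] W,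
        TensorProduct.map (linearAction (g : GL (Fin d) k)).toLinearMap (ρ g) (r • w) =
          r • TensorProduct.map (linearAction (g : GL (Fin d) k)).toLinearMap (ρ g) w := by
      intro w
      induction w with
      | zero => simp
      | add x y hx hy => rw [smul_add, map_add, hx, hy, map_add, smul_add]
      | tmul f w =>
        have hr : linearAction (g : GL (Fin d) k) (r : MvPowerSeries (Fin d) k) = r :=
          r.2 g g.2
        simp only [TensorProduct.smul_tmul', TensorProduct.map_tmul, Subalgebra.smul_def,
          smul_eq_mul, AlgHom.toLinearMap_apply, map_mul, hr]
    rw [key u, hu g]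

/-- The one-dimensional representation of `G` on `k` attached to a character `χ : G → kˣ`. -/
def charRep (G : Subgroup (GL (Fin d) k)) (χ : G →* kˣ) : Representation k G k where
  toFun g := (χ g : k) • LinearMap.id
  map_one' := by ext; simp
  map_mul' g h := by ext; simp [mul_comm]

/-- A pseudoreflection: an element of `GL(d, k)` whose fixed subspace has dimension `d - 1`. -/
def IsPseudoreflection (g : GL (Fin d) k) : Prop :=
  Module.finrank k
    (LinearMap.ker (Matrix.toLin' (g : Matrix (Fin d) (Fin d) k) - LinearMap.id)) + 1 = d

/-- A group is small if it contains no pseudoreflections. -/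
def IsSmall (G : Subgroup (GL (Fin d) k)) : Prop :=
  ∀ g ∈ G, ¬ IsPseudoreflection g

/-- The diagonal matrix `diag(ζ^{t_1}, …, ζ^{t_d})`. -/
def diagElement (ζ : kˣ) (t : Fin d → ℕ) : GL (Fin d) k :=
  Units.map (Matrix.diagonalRingHom (Fin d) k).toMonoidHom
    (MulEquiv.piUnits.symm (fun i => ζ ^ t i))

/-- The cyclic group generated by `diag(ζ^{t_1}, …, ζ^{t_d})`. -/
def diagGroup (ζ : kˣ) (t : Fin d → ℕ) : Subgroup (GL (Fin d) k) :=
  Subgroup.zpowers (diagElement ζ t)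

/-- The generator `diag(ζ^{t_1}, …, ζ^{t_d})`, as an element of the group it generates. -/
def diagGen (ζ : kˣ) (t : Fin d → ℕ) : diagGroup ζ t :=
  ⟨diagElement ζ t, Subgroup.mem_zpowers _⟩

end Invariants

section Frobenius

/-- The `A`-module `A^{1/p^e}`, for `A` of characteristic `p`: the additive group of `A`, on which
`r ∈ A` acts through the `e`-th iterate of Frobenius, `r • x = r^{p^e} x`. An element `x` stands
for `x^{1/p^e}`. -/
def FrobeniusRoot (A : Type u) (_p _e : ℕ) : Type u := A

variable (A : Type u) [CommRing A] (p e : ℕ)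

instance : AddCommGroup (FrobeniusRoot A p e) := inferInstanceAs (AddCommGroup A)

instance [ExpChar A p] : Module A (FrobeniusRoot A p e) :=
  Module.compHom A (iterateFrobenius A p e)

end Frobenius

section Counting

variable {d : ℕ} (p n : ℕ) (t : Fin d → ℕ)

/-- The remainder `r_e` in `p^e = k n + r_e`. -/
def remainder (e : ℕ) : ℕ := p ^ e % n

/-- `g_J = gcd(n, t_j : j ∈ J)`; in particular `g_∅ = n`. -/
def gcdOn (J : Finset (Fin d)) : ℕ := Nat.gcd n (J.gcd t)

/-- `θ_J^{(α)}(e)`: the number of tuples `(a_l)_{l ∉ J}` with `0 ≤ a_l ≤ r_e - 1` and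
`∑ a_l t_l ≡ α` modulo `g_J`; by convention it is `1` if `J` is everything. -/
def theta (α : ℕ) (J : Finset (Fin d)) (e : ℕ) : ℕ :=
  if J = Finset.univ then 1 else
    Nat.card {a : {l : Fin d // l ∉ J} → Fin (remainder p n e) //
      (∑ l, (a l : ℕ) * t l) ≡ α [MOD gcdOn n t J]}

/-- `ψ_i^{(α)}(e) = ∑_{|J| = i} g_J θ_J^{(α)}(e)`. -/
def psi (α i e : ℕ) : ℕ :=
  ∑ J ∈ Finset.powersetCard i (Finset.univ : Finset (Fin d)), gcdOn n t J * theta p n t α J e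

/-- The number `(1/n) ∑_{i=c}^d (-1)^{i-c} C(i,c) ψ_i^{(α)}(e) r_e^{i-c}`. -/
def coeffFormula (α c e : ℕ) : ℚ :=
  (1 / (n : ℚ)) * ∑ i ∈ Finset.Icc c d,
    (-1 : ℚ) ^ (i - c) * (Nat.choose i c : ℚ) * (psi p n t α i e : ℚ) *
      (remainder p n e : ℚ) ^ (i - c)

/-- `φ_0, …, φ_d` are coefficients of `f` as a quasi-polynomial in `p^e`: they are periodic
(hence bounded) functions `ℕ → ℚ`, and `f(e) = ∑_{c=0}^d φ_c(e) p^{ce}` for all `e`. -/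
def IsQuasiPolynomialCoeff (p d : ℕ) (f : ℕ → ℕ) (φ : Fin (d + 1) → ℕ → ℚ) : Prop :=
  (∀ c, ∃ N, 0 < N ∧ Function.Periodic (φ c) N) ∧
    ∀ e, (f e : ℚ) = ∑ c : Fin (d + 1), φ c e * (p : ℚ) ^ ((c : ℕ) * e)

end Counting

end QuotientSingularity

end

open QuotientSingularity

/-!
A power series lies in `M_β` exactly if all its exponents `a` satisfy `n ∣ β + ∑ a_i t_i`
(`mem_semiInvariants_iff`). Writing each exponent of an element of `R` as `b + p^e a` with `b` in
the box `[0, p^e)^d` splits `R^{1/p^e}` into the pieces `x^{b/p^e} M_β`, where `β` is determined by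
`p^e β ≡ ∑ b_l t_l` modulo `n`; since `k` is perfect this is an isomorphism of `R`-modules
(`sumToFrobeniusRoot_bijective`). Hence `M_β` occurs as often as there are box points `b` with
`∑ b_l t_l ≡ p^e β`.

These multiplicities are determined by the module. Smallness says that for every `i` the weights
`t_j` with `j ≠ i` generate `ℤ/n` (`gcdOn_erase_eq_one`), so every `M_β` contains a monomial free
of `x_i`. Therefore a homomorphism `M_β → M_γ`, which is multiplication with a fraction, is
multiplication with a power series (`exists_multiplier`), and the constant term of the latter
vanishes unless `β = γ`. Taking constant terms turns an isomorphism between direct sums of the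
`M_β` into invertible matrices over `k`, one for each `β`, of size given by the multiplicities
(`multiplicity_eq_of_linearEquiv`).

The box points of given weight are counted in the group ring of `ℤ/n` (`card_box_weight`): with
`p^e = q n + r`, each factor `∑_{b < p^e} [b t_l]` is `q` times a sum over all residues plus a sum
over `b < r`, and expanding the product over `l` gives
`(1/n) ∑_J (p^e - r)^{|J|} g_J θ_J`, a polynomial in `p^e` whose coefficients depend only on
`r` and on the residue to be hit, hence are periodic in `e`. Such coefficients are unique because a polynomial has finitely many zeros
(`IsQuasiPolynomialCoeff.unique`).
-/

noncomputable section

namespace QuotientSingularity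

universe u

/-! ### Counting lattice points of a box by weight -/

theorem exists_sum_mul_eq_gcd {ι : Type*} [DecidableEq ι] (t : ι → ℕ) (J : Finset ι) :
    ∃ c : ι → ℤ, ∑ l ∈ J, c l * (t l : ℤ) = (J.gcd t : ℕ) := by
  induction J using Finset.induction_on with
  | empty => exact ⟨0, by simp⟩
  | insert i J hi ih =>
    obtain ⟨c, hc⟩ := ih
    refine ⟨fun l => if l = i then Nat.gcdA (t i) (J.gcd t) else Nat.gcdB (t i) (J.gcd t) * c l, ?_⟩
    have h : ∑ l ∈ J, (if l = i then Nat.gcdA (t i) (J.gcd t)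
        else Nat.gcdB (t i) (J.gcd t) * c l) * (t l : ℤ) =
        Nat.gcdB (t i) (J.gcd t) * (J.gcd t : ℕ) := by
      rw [← hc, Finset.mul_sum]
      refine Finset.sum_congr rfl fun l hl => ?_
      rw [if_neg (by rintro rfl; exact hi hl), mul_assoc]
    rw [Finset.sum_insert hi, h, Finset.gcd_insert]
    change (if i = i then _ else _) * _ + _ = ((Nat.gcd (t i) (J.gcd t) : ℕ) : ℤ)
    rw [if_pos rfl, Nat.gcd_eq_gcd_ab]
    ring

theorem exists_sum_mul_eq_of_gcd_dvd {ι : Type*} [DecidableEq ι] (n : ℕ) (t : ι → ℕ)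
    (J : Finset ι) {s : ℤ} (hs : ((n.gcd (J.gcd t) : ℕ) : ℤ) ∣ s) :
    ∃ c : ι → ZMod n, ∑ l ∈ J, c l * (t l : ZMod n) = s := by
  obtain ⟨c, hc⟩ := exists_sum_mul_eq_gcd t J
  obtain ⟨u, rfl⟩ := hs
  refine ⟨fun l => (u * Nat.gcdB n (J.gcd t) * c l : ℤ), ?_⟩
  have h : ((∑ l ∈ J, (u * Nat.gcdB n (J.gcd t) * c l) * (t l : ℤ) : ℤ) : ZMod n) =
      (((n.gcd (J.gcd t) : ℕ) : ℤ) * u : ℤ) := by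
    simp_rw [mul_assoc]
    rw [← Finset.mul_sum, ← Finset.mul_sum, hc, Nat.gcd_eq_gcd_ab]
    push_cast
    simp
    ring
  rw [← h]
  push_cast
  rfl

/-- The homomorphism `(c_l) ↦ ∑ c_l t_l` on tuples of residues modulo `n`. -/
def weightHom (n : ℕ) {ι : Type*} [Fintype ι] (t : ι → ℕ) : (ι → ZMod n) →+ ZMod n where
  toFun c := ∑ l, c l * (t l : ZMod n)
  map_zero' := by simp
  map_add' c c' := by simp [add_mul, Finset.sum_add_distrib]

theorem range_weightHom {ι : Type*} [Fintype ι] (n : ℕ) (t : ι → ℕ) :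
    (weightHom n t).range =
      AddSubgroup.zmultiples ((n.gcd (Finset.univ.gcd t) : ℕ) : ZMod n) := by
  classical
  set g := n.gcd (Finset.univ.gcd t) with hg
  refine le_antisymm ?_ ?_
  · rintro _ ⟨c, rfl⟩
    refine AddSubgroup.sum_mem _ fun l _ => ?_
    obtain ⟨u, hu⟩ : g ∣ t l := (Nat.gcd_dvd_right _ _).trans (Finset.gcd_dvd (Finset.mem_univ l))
    obtain ⟨v, hv⟩ := ZMod.intCast_surjective (c l)
    refine AddSubgroup.mem_zmultiples_iff.2 ⟨v * u, ?_⟩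
    rw [hu, ← hv, zsmul_eq_mul]
    push_cast
    ring
  · rw [AddSubgroup.zmultiples_le]
    obtain ⟨c, hc⟩ := exists_sum_mul_eq_of_gcd_dvd n t Finset.univ (dvd_refl (g : ℤ))
    exact ⟨c, hc.trans (Int.cast_natCast _)⟩

theorem mem_range_weightHom_iff {ι : Type*} [Fintype ι] {n : ℕ} (t : ι → ℕ) (s : ℤ) :
    (s : ZMod n) ∈ (weightHom n t).range ↔
      ((n.gcd (Finset.univ.gcd t) : ℕ) : ℤ) ∣ s := by
  classical
  constructor
  · intro h
    rw [range_weightHom] at h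
    obtain ⟨v, hv⟩ := AddSubgroup.mem_zmultiples_iff.1 h
    rw [zsmul_eq_mul, ← Int.cast_natCast, ← Int.cast_mul,
      ZMod.intCast_eq_intCast_iff_dvd_sub] at hv
    have h1 := (Int.natCast_dvd_natCast.2 (Nat.gcd_dvd_left n (Finset.univ.gcd t))).trans hv
    exact (dvd_sub_left (dvd_mul_left _ _)).1 h1
  · intro h
    obtain ⟨c, hc⟩ := exists_sum_mul_eq_of_gcd_dvd n t Finset.univ h
    exact ⟨c, hc⟩

/-- A nonempty fibre of `(c_l) ↦ ∑ c_l t_l` on `(ℤ/n)^ι` has `n ^ |ι| · g / n` elements, where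
`g = gcd(n, t_l)`: the image is `g ℤ/n`, of order `n / g`. -/
theorem card_fiber_weightHom_mul {ι : Type*} [Fintype ι] {n : ℕ} [NeZero n] (t : ι → ℕ) (s : ℤ) :
    Nat.card {c : ι → ZMod n // ∑ l, c l * (t l : ZMod n) = s} * n =
      if ((n.gcd (Finset.univ.gcd t) : ℕ) : ℤ) ∣ s then
        n ^ Fintype.card ι * n.gcd (Finset.univ.gcd t) else 0 := by
  classical
  set g := n.gcd (Finset.univ.gcd t) with hg
  have hgn : g ∣ n := Nat.gcd_dvd_left _ _
  have hn : 0 < n := NeZero.pos n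
  split_ifs with h
  · have hcr : Nat.card (weightHom n t).range = n / g := by
      rw [range_weightHom, Nat.card_zmultiples, ZMod.addOrderOf_coe _ hn.ne', ← hg,
        Nat.gcd_eq_right hgn]
    have hk : Nat.card (weightHom n t).ker * (n / g) = n ^ Fintype.card ι := by
      rw [← hcr, mul_comm, ← Nat.card_congr (QuotientAddGroup.quotientKerEquivRange
        (weightHom n t)).toEquiv, ← AddSubgroup.card_eq_card_quotient_mul_card_addSubgroup]
      simp
    have hf : Nat.card {c : ι → ZMod n // ∑ l, c l * (t l : ZMod n) = s} =
        Nat.card (weightHom n t).ker := by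
      obtain ⟨c₀, hc₀⟩ := (mem_range_weightHom_iff (n := n) t s).2 h
      refine Nat.card_congr ((Equiv.subRight c₀).subtypeEquiv fun c => ?_)
      rw [Equiv.subRight_apply, AddMonoidHom.mem_ker, map_sub, hc₀, sub_eq_zero]
      rfl
    rw [hf, ← hk, mul_assoc, Nat.div_mul_cancel hgn]
  · rw [mul_eq_zero]
    left
    rw [Nat.card_eq_zero]
    left
    refine ⟨fun ⟨c, hc⟩ => h ?_⟩
    exact (mem_range_weightHom_iff (n := n) t s).1 ⟨c, hc⟩

section GroupRing

open AddMonoidAlgebra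

theorem prod_sum_single {A ι : Type*} [AddCommMonoid A] [Fintype ι] [DecidableEq ι]
    {κ : ι → Type*} [∀ i, Fintype (κ i)] (w : ∀ i, κ i → A) :
    ∏ i, ∑ b, (single (w i b) 1 : AddMonoidAlgebra ℕ A) =
      ∑ x : ∀ i, κ i, single (∑ i, w i (x i)) 1 := by
  rw [Fintype.prod_sum]
  refine Finset.sum_congr rfl fun x _ => ?_
  have h := map_prod (AddMonoidAlgebra.of ℕ A) (fun i => Multiplicative.ofAdd (w i (x i)))
    Finset.univ
  rw [← ofAdd_sum] at h
  exact h.symm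

theorem coeff_sum_single {A ι : Type*} [AddCommMonoid A] [Fintype ι] (w : ι → A) (s : A) :
    (∑ x, (single (w x) 1 : AddMonoidAlgebra ℕ A)).coeff s = Nat.card {x // w x = s} := by
  classical
  rw [coeff_sum, Finsupp.finsetSum_apply, Nat.card_eq_fintype_card, Fintype.card_subtype,
    Finset.card_filter]
  refine Finset.sum_congr rfl fun x _ => ?_
  rw [coeff_single, Finsupp.single_apply]

theorem sum_range_zmod {n : ℕ} [NeZero n] {B : Type*} [AddCommMonoid B] (f : ZMod n → B) :
    ∑ x ∈ Finset.range n, f x = ∑ c, f c := by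
  obtain _ | n := n
  · exact absurd rfl (NeZero.ne 0)
  · rw [← Fin.sum_univ_eq_sum_range (fun x => f x)]
    refine Finset.sum_congr rfl fun x _ => ?_
    congr 1
    exact Fin.cast_val_eq_self x

theorem sum_range_mul_add_zmod {n : ℕ} [NeZero n] {B : Type*} [AddCommMonoid B]
    (f : ZMod n → B) (q r : ℕ) :
    ∑ x ∈ Finset.range (q * n + r), f x = q • ∑ c, f c + ∑ x ∈ Finset.range r, f x := by
  rw [Finset.sum_range_add]
  congr 1
  · induction q with
    | zero => simp
    | succ q ih =>
      rw [add_mul, one_mul, Finset.sum_range_add, ih, succ_nsmul, ← sum_range_zmod f]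
      simp
  · simp

/-- The number of lattice points `b` of the box `[0, q n + r)^d` with `∑ b_l t_l ≡ α` modulo `n`.
Each side of the box is cut into `q` full periods and a remainder of length `r`; the index `J`
records the coordinates that lie in full periods, where only the residues modulo `n` matter. -/
theorem card_box_weight {d : ℕ} {n : ℕ} [NeZero n] (t : Fin d → ℕ) (q r α : ℕ) :
    n * Nat.card {b : Fin d → Fin (q * n + r) // (∑ l, (b l : ℕ) * t l) ≡ α [MOD n]} =
      ∑ J : Finset (Fin d), (q * n) ^ J.card * (gcdOn n t J *
        Nat.card {a : {l : Fin d // l ∉ J} → Fin r //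
          (∑ l, (a l : ℕ) * t l) ≡ α [MOD gcdOn n t J]}) := by
  classical
  have key : ∀ m : ℕ, ∀ ι : Type, ∀ [Fintype ι] [DecidableEq ι] (t : ι → ℕ),
      ∏ l : ι, ∑ b ∈ Finset.range m, (single ((b : ZMod n) * t l) 1 : AddMonoidAlgebra ℕ (ZMod n)) =
        ∑ x : ι → Fin m, single (((∑ l, (x l : ℕ) * t l : ℕ) : ZMod n)) 1 := by
    intro m ι _ _ t
    simp_rw [← Fin.sum_univ_eq_sum_range
      (fun b => (single ((b : ZMod n) * _) 1 : AddMonoidAlgebra ℕ (ZMod n))) m]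
    rw [prod_sum_single (κ := fun _ => Fin m) (fun l b => ((b : ℕ) : ZMod n) * t l)]
    push_cast
    rfl
  have h1 : Nat.card {b : Fin d → Fin (q * n + r) // (∑ l, (b l : ℕ) * t l) ≡ α [MOD n]} =
      (∏ l, ∑ b ∈ Finset.range (q * n + r),
        (single ((b : ZMod n) * t l) 1 : AddMonoidAlgebra ℕ (ZMod n))).coeff (α : ZMod n) := by
    rw [key, coeff_sum_single]
    simp_rw [ZMod.natCast_eq_natCast_iff]
  rw [h1]
  rw [Finset.prod_congr rfl fun l _ => sum_range_mul_add_zmod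
    (fun x : ZMod n => (single (x * t l) 1 : AddMonoidAlgebra ℕ (ZMod n))) q r]
  rw [Fintype.prod_add, coeff_sum, Finsupp.finsetSum_apply, Finset.mul_sum]
  refine Finset.sum_congr rfl fun J _ => ?_
  -- The coordinates in `J` run over all residues, the others over the remainder of length `r`.
  have hfull : ∏ l ∈ J, q • ∑ c, (single (c * (t l : ZMod n)) 1 : AddMonoidAlgebra ℕ (ZMod n)) =
      q ^ J.card • ∑ c : J → ZMod n, single (∑ l, c l * (t l : ZMod n)) 1 := by
    rw [← Finset.prod_coe_sort, ← prod_sum_single (κ := fun _ : J => ZMod n)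
      (fun l c => c * (t l : ZMod n))]
    simp_rw [nsmul_eq_mul]
    rw [Finset.prod_mul_distrib, Finset.prod_const, Finset.card_univ, Fintype.card_coe,
      Nat.cast_pow]
  have hrest : ∏ l ∈ Jᶜ, ∑ b ∈ Finset.range r,
      (single ((b : ZMod n) * t l) 1 : AddMonoidAlgebra ℕ (ZMod n)) =
        ∑ x : {l : Fin d // l ∉ J} → Fin r,
          single (((∑ l, (x l : ℕ) * t l : ℕ) : ZMod n)) 1 := by
    rw [← key r {l : Fin d // l ∉ J} (fun l => t l)]
    exact Finset.prod_subtype _ (fun l => Finset.mem_compl) _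
  have hgcd : (Finset.univ : Finset J).gcd (fun l => t l) = J.gcd t := by
    conv_rhs => rw [← Finset.attach_image_val (s := J), Finset.gcd_image]
    rfl
  have hfib : ∀ x : {l : Fin d // l ∉ J} → Fin r,
      n * Nat.card {c : J → ZMod n // ∑ l, c l * (t l : ZMod n) =
        ((α - (∑ l, (x l : ℕ) * t l : ℕ) : ℤ) : ZMod n)} =
      n ^ J.card * gcdOn n t J *
        if (∑ l, (x l : ℕ) * t l) ≡ α [MOD gcdOn n t J] then 1 else 0 := by
    intro x
    rw [mul_comm n, card_fiber_weightHom_mul (fun l : J => t l), hgcd, Fintype.card_coe, mul_ite,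
      mul_one, mul_zero]
    simp_rw [Nat.modEq_iff_dvd]
    rfl
  rw [hfull, hrest, smul_mul_assoc, coeff_smul, Finset.sum_mul_sum, Finset.sum_comm]
  simp_rw [single_mul_single, mul_one]
  rw [coeff_sum, Finsupp.smul_apply, Finsupp.finsetSum_apply]
  simp_rw [coeff_sum_single]
  have hsub : ∀ x : {l : Fin d // l ∉ J} → Fin r,
      Nat.card {c : J → ZMod n // ∑ l, c l * (t l : ZMod n) +
        ((∑ l, (x l : ℕ) * t l : ℕ) : ZMod n) = α} =
      Nat.card {c : J → ZMod n // ∑ l, c l * (t l : ZMod n) =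
        ((α - (∑ l, (x l : ℕ) * t l : ℕ) : ℤ) : ZMod n)} := by
    intro x
    refine Nat.card_congr (Equiv.subtypeEquivRight fun c => ?_)
    rw [Int.cast_sub, Int.cast_natCast, Int.cast_natCast, eq_sub_iff_add_eq]
  simp_rw [hsub]
  rw [smul_eq_mul, mul_left_comm, Finset.mul_sum]
  simp_rw [hfib]
  rw [← Finset.mul_sum, ← Finset.card_filter, ← Fintype.card_subtype, ← Nat.card_eq_fintype_card]
  ring

end GroupRing

/-! ### Quasi-polynomial coefficients -/

theorem sum_card_pow_mul_eq {d : ℕ} (p n : ℕ) (t : Fin d → ℕ)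
    (hg : gcdOn n t Finset.univ = 1) (α e : ℕ) (X : ℕ) :
    ∑ J : Finset (Fin d), X ^ J.card * (gcdOn n t J *
        Nat.card {a : {l : Fin d // l ∉ J} → Fin (remainder p n e) //
          (∑ l, (a l : ℕ) * t l) ≡ α [MOD gcdOn n t J]}) =
      ∑ i ∈ Finset.range (d + 1), X ^ i * psi p n t α i e := by
  classical
  rw [← Finset.powerset_univ, Finset.sum_powerset, Finset.card_univ, Fintype.card_fin]
  refine Finset.sum_congr rfl fun i _ => ?_
  rw [psi, Finset.mul_sum]
  refine Finset.sum_congr rfl fun J hJ => ?_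
  rw [(Finset.mem_powersetCard.1 hJ).2, theta]
  split_ifs with h
  · subst h
    rw [hg, Nat.card_eq_one_iff_unique.2]
    have : IsEmpty {l : Fin d // l ∉ (Finset.univ : Finset (Fin d))} :=
      ⟨fun l => l.2 (Finset.mem_univ _)⟩
    exact ⟨⟨fun a b => Subtype.ext (Subsingleton.elim _ _)⟩,
      ⟨⟨fun l => (this.false l).elim, Nat.modEq_one⟩⟩⟩
  · rfl

/-- Re-expansion of a polynomial in `P - r` as a polynomial in `P`. -/
theorem sum_sub_pow_mul {K : Type*} [CommRing K] (d : ℕ) (a : ℕ → K) (P r : K) :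
    ∑ i ∈ Finset.range (d + 1), (P - r) ^ i * a i =
      ∑ c : Fin (d + 1), (∑ i ∈ Finset.Icc (c : ℕ) d,
        (-1) ^ (i - c) * (i.choose c : K) * a i * r ^ (i - c)) * P ^ (c : ℕ) := by
  rw [Fin.sum_univ_eq_sum_range (fun c => (∑ i ∈ Finset.Icc c d,
        (-1) ^ (i - c) * (i.choose c : K) * a i * r ^ (i - c)) * P ^ c) (d + 1)]
  simp_rw [sub_eq_add_neg, add_pow, Finset.sum_mul]
  rw [Finset.sum_comm' (t' := Finset.range (d + 1)) (s' := fun c => Finset.Icc c d)]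
  · refine Finset.sum_congr rfl fun c _ => Finset.sum_congr rfl fun i _ => ?_
    rw [neg_pow r]
    ring
  · intro i c
    simp only [Finset.mem_range, Finset.mem_Icc]
    omega

theorem card_box_eq_sum_coeffFormula {d : ℕ} {p n : ℕ} (hn : 0 < n) (t : Fin d → ℕ)
    (hg : gcdOn n t Finset.univ = 1) (α e : ℕ) :
    (Nat.card {b : Fin d → Fin (p ^ e) // (∑ l, (b l : ℕ) * t l) ≡ α [MOD n]} : ℚ) =
      ∑ c : Fin (d + 1), coeffFormula p n t α c e * (p : ℚ) ^ ((c : ℕ) * e) := by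
  have : NeZero n := ⟨hn.ne'⟩
  have hP : p ^ e / n * n + remainder p n e = p ^ e := Nat.div_add_mod' _ _
  have h := card_box_weight (n := n) t (p ^ e / n) (remainder p n e) α
  rw [sum_card_pow_mul_eq p n t hg, hP] at h
  have hP' : ((p ^ e / n * n : ℕ) : ℚ) = (p : ℚ) ^ e - remainder p n e := by
    rw [eq_sub_iff_add_eq]
    exact_mod_cast hP
  have h' := congrArg (Nat.cast : ℕ → ℚ) h
  rw [Nat.cast_mul, Nat.cast_sum] at h'
  simp_rw [Nat.cast_mul _ (psi _ _ _ _ _ _), Nat.cast_pow _ _, hP'] at h'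
  rw [sum_sub_pow_mul d (fun i => (psi p n t α i e : ℚ))] at h'
  have hn' : (n : ℚ) ≠ 0 := by exact_mod_cast hn.ne'
  rw [← mul_right_inj' hn', h', Finset.mul_sum]
  refine Finset.sum_congr rfl fun c _ => ?_
  rw [coeffFormula, ← mul_assoc, ← mul_assoc, mul_one_div_cancel hn', one_mul, ← pow_mul,
    mul_comm e]

theorem coeffFormula_congr {d p n : ℕ} (t : Fin d → ℕ) {e e' : ℕ}
    (h : remainder p n e = remainder p n e') (α c : ℕ) :
    coeffFormula p n t α c e = coeffFormula p n t α c e' := by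
  unfold coeffFormula psi theta
  rw [h]

theorem remainder_add_totient {p n : ℕ} (h : p.Coprime n) (e : ℕ) :
    remainder p n (e + n.totient) = remainder p n e := by
  have := (Nat.ModEq.pow_totient h).mul_left (p ^ e)
  rwa [← pow_add, mul_one] at this

/-- Quasi-polynomial coefficients are unique: along a common period the difference of two choices
is a genuine polynomial with infinitely many zeros. -/
theorem IsQuasiPolynomialCoeff.unique {p d : ℕ} (hp : 1 < p) {f : ℕ → ℕ}
    {φ ψ : Fin (d + 1) → ℕ → ℚ} (hφ : IsQuasiPolynomialCoeff p d f φ)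
    (hψ : IsQuasiPolynomialCoeff p d f ψ) : φ = ψ := by
  have hδ : ∀ c, ∃ N, 0 < N ∧ Function.Periodic (φ c - ψ c) N := by
    intro c
    obtain ⟨N, hN, h⟩ := hφ.1 c
    obtain ⟨N', hN', h'⟩ := hψ.1 c
    refine ⟨N' * N, Nat.mul_pos hN' hN, ?_⟩
    have h1 := h.nat_mul N'
    have h2 := h'.nat_mul N
    rw [Nat.cast_id, mul_comm] at h2
    exact Function.Periodic.sub h1 h2
  choose N hN hper using hδ
  have hcommon : ∀ c, Function.Periodic (φ c - ψ c) (∏ i, N i) := by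
    intro c
    obtain ⟨u, hu⟩ := Finset.dvd_prod_of_mem N (Finset.mem_univ c)
    rw [hu, mul_comm]
    exact (hper c).nat_mul u
  set M := ∏ i, N i
  have hM : 0 < M := Finset.prod_pos fun i _ => hN i
  have hall : ∀ e c, φ c e - ψ c e = 0 := by
    intro e
    let P : Polynomial ℚ := ∑ c : Fin (d + 1), Polynomial.monomial (c : ℕ) (φ c e - ψ c e)
    have hroot : ∀ j : ℕ, P.eval ((p : ℚ) ^ (e + j * M)) = 0 := by
      intro j
      have h1 := (hφ.2 (e + j * M)).symm.trans (hψ.2 (e + j * M))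
      rw [← sub_eq_zero, ← Finset.sum_sub_distrib] at h1
      rw [Polynomial.eval_finsetSum, ← h1]
      refine Finset.sum_congr rfl fun c _ => ?_
      have h2 : φ c (e + j * M) - ψ c (e + j * M) = φ c e - ψ c e := (hcommon c).nat_mul j e
      rw [Polynomial.eval_monomial, ← h2, ← pow_mul, mul_comm (c : ℕ), sub_mul]
    have hinj : Function.Injective fun j : ℕ => (p : ℚ) ^ (e + j * M) := by
      intro i j hij
      have hij' : p ^ (e + i * M) = p ^ (e + j * M) := by
        dsimp only at hij
        exact_mod_cast hij
      have := Nat.pow_right_injective hp hij'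
      exact Nat.eq_of_mul_eq_mul_right hM (by omega)
    have hP : P = 0 := P.eq_zero_of_infinite_isRoot
      ((Set.infinite_range_of_injective hinj).mono (by rintro _ ⟨j, rfl⟩; exact hroot j))
    intro c
    have := congrArg (fun Q => Polynomial.coeff Q (c : ℕ)) hP
    simpa [P, Polynomial.finsetSum_coeff, Polynomial.coeff_monomial, Fin.val_inj] using this
  funext c e
  exact sub_eq_zero.1 (hall e c)

theorem isQuasiPolynomialCoeff_iff {d p n : ℕ} (hp : 1 < p) (hn : 0 < n) (hpn : p.Coprime n)
    (t : Fin d → ℕ) (hg : gcdOn n t Finset.univ = 1) (α : ℕ → ℕ)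
    (hα : Function.Periodic α n.totient) {f : ℕ → ℕ}
    (hf : ∀ e, f e =
      Nat.card {b : Fin d → Fin (p ^ e) // (∑ l, (b l : ℕ) * t l) ≡ α e [MOD n]})
    (φ : Fin (d + 1) → ℕ → ℚ) :
    IsQuasiPolynomialCoeff p d f φ ↔ ∀ c e, φ c e = coeffFormula p n t (α e) c e := by
  have h : IsQuasiPolynomialCoeff p d f (fun c e => coeffFormula p n t (α e) c e) := by
    refine ⟨fun c => ⟨n.totient, Nat.totient_pos.2 hn, fun e => ?_⟩, fun e => ?_⟩
    · change coeffFormula p n t (α (e + n.totient)) c (e + n.totient) = _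
      rw [hα e, coeffFormula_congr t (remainder_add_totient hpn e)]
    · rw [hf, card_box_eq_sum_coeffFormula hn t hg]
  constructor
  · intro hφ c e
    rw [hφ.unique hp h]
  · intro hφ
    rwa [show φ = fun (c : Fin (d + 1)) e => coeffFormula p n t (α e) c e from funext₂ hφ]

/-! ### The diagonal action and its semi-invariants -/

section Diagonal

open MvPowerSeries

variable {k : Type u} [Field k] {d : ℕ}

/-- The weight `∑ a_i t_i` of the monomial `x^a`, on which `diag(ζ^{t_1}, …, ζ^{t_d})` acts by
`ζ` to this power. -/
def weight (t : Fin d → ℕ) (a : Fin d →₀ ℕ) : ℕ := ∑ i, a i * t i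

theorem weight_add (t : Fin d → ℕ) (a b : Fin d →₀ ℕ) :
    weight t (a + b) = weight t a + weight t b := by
  simp [weight, add_mul, Finset.sum_add_distrib]

theorem weight_smul (t : Fin d → ℕ) (m : ℕ) (a : Fin d →₀ ℕ) :
    weight t (m • a) = m * weight t a := by
  simp [weight, Finset.mul_sum, mul_assoc]

theorem diagElement_coe (ζ : kˣ) (t : Fin d → ℕ) :
    ((diagElement ζ t : GL (Fin d) k) : Matrix (Fin d) (Fin d) k) =
      Matrix.diagonal fun i => (ζ : k) ^ t i := by
  simp [diagElement]

theorem diagElement_mul (ζ ξ : kˣ) (t : Fin d → ℕ) :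
    diagElement ζ t * diagElement ξ t = diagElement (ζ * ξ) t := by
  simp_rw [diagElement, ← map_mul, mul_pow]
  rfl

theorem diagElement_zpow (ζ : kˣ) (t : Fin d → ℕ) (j : ℤ) :
    diagElement ζ t ^ j = diagElement (ζ ^ j) t :=
  (map_zpow (MonoidHom.mk' (fun ζ => diagElement (k := k) ζ t)
    fun ζ ξ => (diagElement_mul ζ ξ t).symm) ζ j).symm

theorem coeff_linearAction_diagElement (ζ : kˣ) (t : Fin d → ℕ) (f : MvPowerSeries (Fin d) k)
    (a : Fin d →₀ ℕ) :
    coeff a (linearAction (diagElement ζ t) f) = (ζ : k) ^ weight t a * coeff a f := by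
  have h : (fun j : Fin d => (∑ i, (diagElement ζ t : Matrix (Fin d) (Fin d) k) i j •
      MvPowerSeries.X i : MvPowerSeries (Fin d) k)) =
      (fun i => (ζ : k) ^ t i) • MvPowerSeries.X := by
    funext j
    rw [Finset.sum_eq_single j, diagElement_coe]
    · simp
    · intro i _ hij
      rw [diagElement_coe, Matrix.diagonal_apply_ne _ hij, zero_smul]
    · simp
  have h2 : linearAction (diagElement ζ t) f = rescale (fun i => (ζ : k) ^ t i) f := by
    rw [linearAction, MvPowerSeries.coe_substAlgHom, h, rescale_eq_subst]
  rw [h2, coeff_rescale, Finsupp.prod_fintype _ _ (fun i => pow_zero _), weight,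
    ← Finset.prod_pow_eq_pow_sum]
  simp_rw [← pow_mul, mul_comm]

/-- The semi-invariants of `G` in `S` for the character `χ⁻¹`: the power series `f` with
`χ(g) (g · f) = f` for all `g ∈ G`. -/
def semiInvariants (G : Subgroup (GL (Fin d) k)) (χ : G →* kˣ) :
    Submodule (invariantRing G) (MvPowerSeries (Fin d) k) where
  carrier := {f | ∀ g : G, (χ g : k) • linearAction (g : GL (Fin d) k) f = f}
  zero_mem' g := by rw [map_zero, smul_zero]
  add_mem' hf hf' g := by rw [map_add, smul_add, hf g, hf' g]
  smul_mem' r f hf g := by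
    rw [Subalgebra.smul_def, smul_eq_mul, map_mul, r.2 g g.2, ← mul_smul_comm, hf g]

theorem rid_map_charRep (G : Subgroup (GL (Fin d) k)) (χ : G →* kˣ) (g : G)
    (u : MvPowerSeries (Fin d) k ⊗[k] k) :
    TensorProduct.rid k _ (TensorProduct.map (linearAction (g : GL (Fin d) k)).toLinearMap
      (charRep G χ g) u) =
      (χ g : k) • linearAction (g : GL (Fin d) k) (TensorProduct.rid k _ u) := by
  induction u with
  | zero => simp
  | add x y hx hy => simp only [map_add, hx, hy, smul_add]
  | tmul f w => simp [charRep, mul_smul]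

/-- The covariants of a one-dimensional representation are the semi-invariants, through
`S ⊗ k ≃ S`. -/
def covariantsEquiv (G : Subgroup (GL (Fin d) k)) (χ : G →* kˣ) :
    covariants G (charRep G χ) ≃ₗ[invariantRing G] semiInvariants G χ where
  toFun u := ⟨TensorProduct.rid k _ u.1, fun g => by rw [← rid_map_charRep, u.2 g]⟩
  invFun f := ⟨(TensorProduct.rid k _).symm f.1, fun g => by
    rw [← (TensorProduct.rid k _).injective.eq_iff, rid_map_charRep, LinearEquiv.apply_symm_apply,
      f.2 g]⟩
  left_inv u := Subtype.ext ((TensorProduct.rid k _).symm_apply_apply _)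
  right_inv f := Subtype.ext ((TensorProduct.rid k _).apply_symm_apply _)
  map_add' u v := Subtype.ext (map_add _ _ _)
  map_smul' r u := Subtype.ext <|
    map_smul (TensorProduct.AlgebraTensorModule.rid k (MvPowerSeries (Fin d) k)
      (MvPowerSeries (Fin d) k)) (r : MvPowerSeries (Fin d) k) u.1

variable {n : ℕ} {ζ : kˣ} (hζ : IsPrimitiveRoot ζ n) (t : Fin d → ℕ)
include hζ

theorem mem_semiInvariants_iff {χ : diagGroup ζ t →* kˣ} {β : ℕ}
    (hχ : χ (diagGen ζ t) = ζ ^ β) (f : MvPowerSeries (Fin d) k) :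
    f ∈ semiInvariants (diagGroup ζ t) χ ↔ ∀ a, coeff a f ≠ 0 → n ∣ β + weight t a := by
  constructor
  · intro hf a ha
    have h := congrArg (coeff a) (hf (diagGen ζ t))
    rw [hχ, coeff_smul] at h
    change _ * coeff a (linearAction (diagElement ζ t) f) = _ at h
    rw [coeff_linearAction_diagElement, ← mul_assoc, Units.val_pow_eq_pow_val, ← pow_add] at h
    refine hζ.dvd_of_pow_eq_one _ (Units.ext ?_)
    rw [Units.val_pow_eq_pow_val, Units.val_one]
    exact mul_right_cancel₀ ha (h.trans (one_mul _).symm)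
  · rintro hf ⟨g, hg⟩
    obtain ⟨j, rfl⟩ := Subgroup.mem_zpowers_iff.1 hg
    have hχj : χ ⟨diagElement ζ t ^ j, hg⟩ = (ζ ^ j) ^ β := by
      have : (⟨diagElement ζ t ^ j, hg⟩ : diagGroup ζ t) = diagGen ζ t ^ j := Subtype.ext rfl
      rw [this, map_zpow, hχ, ← zpow_natCast, ← zpow_natCast, zpow_comm]
    ext a
    rw [hχj, coeff_smul]
    change _ * coeff a (linearAction (diagElement ζ t ^ j) f) = _
    rw [diagElement_zpow, coeff_linearAction_diagElement, ← mul_assoc, Units.val_pow_eq_pow_val,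
      ← pow_add]
    by_cases ha : coeff a f = 0
    · rw [ha, mul_zero]
    · obtain ⟨u, hu⟩ := hf a ha
      rw [hu, ← Units.val_pow_eq_pow_val, ← zpow_natCast, zpow_comm, zpow_natCast, pow_mul,
        hζ.pow_eq_one]
      simp

theorem mem_invariantRing_iff (f : MvPowerSeries (Fin d) k) :
    f ∈ invariantRing (diagGroup ζ t) ↔ ∀ a, coeff a f ≠ 0 → n ∣ weight t a := by
  have h := mem_semiInvariants_iff hζ t (χ := 1) (β := 0) (by simp) f
  simp_rw [zero_add] at h
  rw [← h]
  exact ⟨fun hf g => by simpa using hf g g.2, fun hf g hg => by simpa using hf ⟨g, hg⟩⟩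

theorem monomial_mem_semiInvariants {χ : diagGroup ζ t →* kˣ} {β : ℕ}
    (hχ : χ (diagGen ζ t) = ζ ^ β) {a : Fin d →₀ ℕ} (ha : n ∣ β + weight t a) :
    monomial a (1 : k) ∈ semiInvariants (diagGroup ζ t) χ := by
  classical
  rw [mem_semiInvariants_iff hζ t hχ]
  intro b hb
  rw [coeff_monomial] at hb
  rwa [(ite_ne_right_iff.1 hb).1]

/-- The generator has order `n / gcd(n, t_1, …, t_d)`, so this gcd is `1` if `|G| = n`. -/
theorem gcdOn_univ_eq_one (hn : 0 < n) (hcard : Nat.card (diagGroup ζ t) = n) :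
    gcdOn n t Finset.univ = 1 := by
  set g := gcdOn n t Finset.univ with hg
  obtain ⟨u, hu⟩ : g ∣ n := Nat.gcd_dvd_left _ _
  have hpow : diagElement ζ t ^ u = 1 := by
    rw [← zpow_natCast, diagElement_zpow, zpow_natCast]
    refine Units.ext ?_
    rw [diagElement_coe, Units.val_one, ← Matrix.diagonal_one]
    congr 1
    funext i
    obtain ⟨v, hv⟩ : g ∣ t i := (Nat.gcd_dvd_right _ _).trans (Finset.gcd_dvd (Finset.mem_univ i))
    have : (ζ ^ u) ^ t i = 1 := by
      rw [← pow_mul, hv, ← mul_assoc, mul_comm u, ← hu, pow_mul, hζ.pow_eq_one, one_pow]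
    rw [← Units.val_pow_eq_pow_val, this, Units.val_one]
  have hord : n ∣ u := by
    rw [← hcard, diagGroup, Nat.card_zpowers]
    exact orderOf_dvd_of_pow_eq_one hpow
  obtain ⟨v, rfl⟩ := hord
  have hv : n * 1 = n * (g * v) := by linarith
  exact Nat.eq_one_of_mul_eq_one_right (Nat.eq_of_mul_eq_mul_left hn hv).symm

/-- If the weights `t_j` with `j ≠ i` do not generate `ℤ/n`, some nontrivial power of the
generator fixes all `x_j` with `j ≠ i`; it is a pseudoreflection. -/
theorem gcdOn_erase_eq_one (hn : 0 < n) (hcard : Nat.card (diagGroup ζ t) = n)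
    (hsmall : IsSmall (diagGroup ζ t)) (i : Fin d) :
    gcdOn n t (Finset.univ.erase i) = 1 := by
  by_contra hne
  set g := gcdOn n t (Finset.univ.erase i) with hg
  obtain ⟨u, hu⟩ : g ∣ n := Nat.gcd_dvd_left _ _
  have hfix : ∀ j, j ≠ i → (ζ ^ u) ^ t j = 1 := by
    intro j hj
    obtain ⟨v, hv⟩ : g ∣ t j := (Nat.gcd_dvd_right _ _).trans
      (Finset.gcd_dvd (Finset.mem_erase.2 ⟨hj, Finset.mem_univ j⟩))
    rw [← pow_mul, hv, ← mul_assoc, mul_comm u, ← hu, pow_mul, hζ.pow_eq_one, one_pow]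
  have hmove : (ζ ^ u) ^ t i ≠ 1 := by
    intro h
    rw [← pow_mul] at h
    have h1 : g * u ∣ u * t i := hu ▸ hζ.dvd_of_pow_eq_one _ h
    have hu0 : 0 < u := Nat.pos_of_ne_zero (by rintro rfl; omega)
    have h2 : g ∣ t i := Nat.dvd_of_mul_dvd_mul_left hu0 (by rwa [mul_comm u g])
    have h3 : g ∣ gcdOn n t Finset.univ := by
      refine Nat.dvd_gcd ⟨u, hu⟩ (Finset.dvd_gcd fun j _ => ?_)
      by_cases hj : j = i
      · rwa [hj]
      · exact (Nat.gcd_dvd_right _ _).trans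
          (Finset.gcd_dvd (Finset.mem_erase.2 ⟨hj, Finset.mem_univ j⟩))
    rw [gcdOn_univ_eq_one hζ t hn hcard] at h3
    exact hne (Nat.dvd_one.1 h3)
  refine hsmall (diagElement ζ t ^ (u : ℤ)) (Subgroup.mem_zpowers_iff.2 ⟨u, rfl⟩) ?_
  rw [diagElement_zpow, zpow_natCast, IsPseudoreflection, diagElement_coe]
  have hker : LinearMap.ker (Matrix.toLin' (Matrix.diagonal fun j => ((ζ ^ u : kˣ) : k) ^ t j) -
      LinearMap.id) = LinearMap.ker (LinearMap.proj (R := k) (φ := fun _ : Fin d => k) i) := by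
    ext v
    rw [LinearMap.mem_ker, LinearMap.mem_ker, LinearMap.proj_apply, LinearMap.sub_apply,
      sub_eq_zero]
    simp only [Matrix.toLin'_apply, LinearMap.id_apply]
    constructor
    · intro h
      have h1 := congrFun h i
      rw [Matrix.mulVec_diagonal] at h1
      by_contra hv
      refine hmove (Units.ext ?_)
      push_cast
      exact mul_right_cancel₀ hv (by push_cast at h1; rw [h1, one_mul])
    · intro h
      funext j
      rw [Matrix.mulVec_diagonal]
      by_cases hj : j = i
      · rw [hj, h, mul_zero]
      · have := congrArg Units.val (hfix j hj)
        push_cast at this ⊢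
        rw [this, one_mul]
  rw [hker]
  have := LinearMap.finrank_range_add_finrank_ker
    (LinearMap.proj (R := k) (φ := fun _ : Fin d => k) i)
  rw [LinearMap.range_eq_top.2 (LinearMap.proj_surjective i), finrank_top, Module.finrank_self,
    Module.finrank_fin_fun] at this
  omega

end Diagonal

/-! ### The decomposition of the Frobenius root -/

section FrobeniusDecomposition

open MvPowerSeries

variable {k : Type u} [Field k] {d : ℕ}

/-- A tuple of bounded natural numbers, as an exponent vector. -/
def boxExponent {P : ℕ} (b : Fin d → Fin P) : Fin d →₀ ℕ :=
  Finsupp.equivFunOnFinite.symm fun l => (b l : ℕ)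

/-- Every exponent vector is `b + P a` with `b` in the box `[0, P)^d`. -/
theorem exists_eq_boxExponent_add {P : ℕ} (hP : 0 < P) (c : Fin d →₀ ℕ) :
    ∃ (b : Fin d → Fin P) (a : Fin d →₀ ℕ), c = boxExponent b + P • a := by
  refine ⟨fun l => ⟨c l % P, Nat.mod_lt _ hP⟩,
    Finsupp.equivFunOnFinite.symm fun l => c l / P, Finsupp.ext fun l => ?_⟩
  simp [boxExponent, Nat.mod_add_div]

theorem boxExponent_add_injective {P : ℕ} {b b' : Fin d → Fin P} {a a' : Fin d →₀ ℕ}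
    (h : boxExponent b + P • a = boxExponent b' + P • a') : b = b' ∧ a = a' := by
  have h' : ∀ l, (b l : ℕ) + P * a l = b' l + P * a' l := fun l => by
    simpa [boxExponent] using DFunLike.congr_fun h l
  have hb : b = b' := by
    funext l
    have := congrArg (· % P) (h' l)
    simpa [Nat.add_mul_mod_self_left, Nat.mod_eq_of_lt (b l).2, Nat.mod_eq_of_lt (b' l).2,
      Fin.val_inj] using this
  subst hb
  refine ⟨rfl, Finsupp.ext fun l => ?_⟩
  have hP : 0 < P := (Nat.zero_le _).trans_lt (b l).2
  exact Nat.eq_of_mul_eq_mul_left hP (Nat.add_left_cancel (h' l))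

theorem coeff_pow_char_pow {p : ℕ} [ExpChar k p] (e : ℕ) (f : MvPowerSeries (Fin d) k)
    (a : Fin d →₀ ℕ) : coeff (p ^ e • a) (f ^ p ^ e) = coeff a f ^ p ^ e := by
  rw [← map_iterateFrobenius_expand p (expChar_ne_zero k p), coeff_map, coeff_expand_smul,
    iterateFrobenius_def]

theorem exists_of_coeff_pow_char_pow_ne_zero {p : ℕ} [ExpChar k p] (e : ℕ)
    (f : MvPowerSeries (Fin d) k) {c : Fin d →₀ ℕ} (hc : coeff c (f ^ p ^ e) ≠ 0) :
    ∃ a, c = p ^ e • a := by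
  rw [← map_iterateFrobenius_expand p (expChar_ne_zero k p), coeff_map] at hc
  have h : ∀ l, p ^ e ∣ c l := by
    intro l
    by_contra hl
    rw [coeff_expand_of_not_dvd _ _ _ hl, map_zero] at hc
    exact hc rfl
  choose a ha using h
  exact ⟨Finsupp.equivFunOnFinite.symm a, Finsupp.ext fun l => by simp [ha]⟩

theorem coeff_monomial_mul_pow_char_pow {p : ℕ} [ExpChar k p] (e : ℕ)
    (f : MvPowerSeries (Fin d) k) (b b' : Fin d → Fin (p ^ e)) (a : Fin d →₀ ℕ) :
    coeff (boxExponent b' + p ^ e • a) (monomial (boxExponent b) 1 * f ^ p ^ e) =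
      if b = b' then coeff a f ^ p ^ e else 0 := by
  split_ifs with h
  · rw [h, coeff_add_monomial_mul, one_mul, coeff_pow_char_pow]
  · rw [coeff_monomial_mul]
    split_ifs with hle
    · rw [one_mul]
      by_contra hc
      obtain ⟨a', ha'⟩ := exists_of_coeff_pow_char_pow_ne_zero e f hc
      have := add_tsub_cancel_of_le hle
      rw [ha'] at this
      exact h (boxExponent_add_injective this).1
    · rfl

theorem weight_boxExponent (t : Fin d → ℕ) {P : ℕ} (b : Fin d → Fin P) :
    weight t (boxExponent b) = ∑ l, (b l : ℕ) * t l := rfl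

/-- The points `b` of the box `[0, P)^d` with `∑ b_l t_l ≡ α` modulo `n`. -/
abbrev BoxPoint (n : ℕ) (t : Fin d → ℕ) (P α : ℕ) : Type :=
  {b : Fin d → Fin P // (∑ l, (b l : ℕ) * t l) ≡ α [MOD n]}

variable {n : ℕ} {ζ : kˣ} (hζ : IsPrimitiveRoot ζ n) (t : Fin d → ℕ) (p : ℕ) [ExpChar k p]

theorem dvd_weight_boxExponent_add_iff {P β : ℕ} (hP : P.Coprime n)
    (b : BoxPoint n t P (P * β)) (a : Fin d →₀ ℕ) :
    n ∣ weight t (boxExponent b.1 + P • a) ↔ n ∣ β + weight t a := by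
  have h : weight t (boxExponent b.1 + P • a) ≡ P * (β + weight t a) [MOD n] := by
    rw [weight_add, weight_smul, mul_add]
    exact b.2.add_right _
  rw [h.dvd_iff dvd_rfl]
  exact hP.symm.dvd_mul_left

include hζ in
theorem monomial_mul_pow_mem {χ : diagGroup ζ t →* kˣ} {β : ℕ}
    (hχ : χ (diagGen ζ t) = ζ ^ β) {e : ℕ} (hp : (p ^ e).Coprime n)
    (b : BoxPoint n t (p ^ e) (p ^ e * β)) {f : MvPowerSeries (Fin d) k}
    (hf : f ∈ semiInvariants (diagGroup ζ t) χ) :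
    monomial (boxExponent b.1) 1 * f ^ p ^ e ∈ invariantRing (diagGroup ζ t) := by
  rw [mem_invariantRing_iff hζ]
  intro c hc
  obtain ⟨b', a, rfl⟩ := exists_eq_boxExponent_add (pow_pos (expChar_pos k p) e) c
  rw [coeff_monomial_mul_pow_char_pow] at hc
  obtain ⟨rfl, ha⟩ := ite_ne_right_iff.1 hc
  rw [dvd_weight_boxExponent_add_iff t hp]
  exact (mem_semiInvariants_iff hζ t hχ f).1 hf a fun h => ha (by
    rw [h, zero_pow (pow_pos (expChar_pos k p) e).ne'])

/-- The embedding `f ↦ x^{b/p^e} f` of a module of semi-invariants into `R^{1/p^e}`; on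
`p^e`-th powers it reads `f ↦ x^b f^{p^e}`. -/
def toFrobeniusRoot {χ : diagGroup ζ t →* kˣ} {β : ℕ}
    (hχ : χ (diagGen ζ t) = ζ ^ β) {e : ℕ} (hp : (p ^ e).Coprime n)
    (b : BoxPoint n t (p ^ e) (p ^ e * β)) :
    semiInvariants (diagGroup ζ t) χ →ₗ[invariantRing (diagGroup ζ t)]
      FrobeniusRoot (invariantRing (diagGroup ζ t)) p e where
  toFun f := (⟨monomial (boxExponent b.1) 1 * f.1 ^ p ^ e,
    monomial_mul_pow_mem hζ t p hχ hp b f.2⟩ : invariantRing (diagGroup ζ t))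
  map_add' f g := Subtype.ext <| by
    have : ExpChar (MvPowerSeries (Fin d) k) p :=
      expChar_of_injective_algebraMap (algebraMap k _).injective p
    change _ * (f.1 + g.1) ^ p ^ e = _ * f.1 ^ p ^ e + _ * g.1 ^ p ^ e
    rw [add_pow_expChar_pow, mul_add]
  map_smul' r f := Subtype.ext <| by
    change _ * (r.1 * f.1) ^ p ^ e = r.1 ^ p ^ e * (_ * f.1 ^ p ^ e)
    rw [mul_pow, mul_left_comm]

/-- The sum of the embeddings `f ↦ x^{b/p^e} f`, over all box points `b`. -/
def sumToFrobeniusRoot {χ : Fin n → (diagGroup ζ t →* kˣ)}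
    (hχ : ∀ β : Fin n, χ β (diagGen ζ t) = ζ ^ (β : ℕ)) {e : ℕ} (hp : (p ^ e).Coprime n) :
    ((β : Fin n) → BoxPoint n t (p ^ e) (p ^ e * β) → semiInvariants (diagGroup ζ t) (χ β))
      →ₗ[invariantRing (diagGroup ζ t)] FrobeniusRoot (invariantRing (diagGroup ζ t)) p e :=
  ∑ β, ∑ b, toFrobeniusRoot hζ t p (hχ β) hp b ∘ₗ LinearMap.proj b ∘ₗ LinearMap.proj β

/-- The underlying power series of an element of `R^{1/p^e}`, that is, its `p^e`-th power. -/
def frobeniusRootVal (G : Subgroup (GL (Fin d) k)) (e : ℕ) :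
    FrobeniusRoot (invariantRing G) p e →+ MvPowerSeries (Fin d) k :=
  (invariantRing G).val.toRingHom.toAddMonoidHom

omit [ExpChar k p] in
theorem frobeniusRootVal_mem (G : Subgroup (GL (Fin d) k)) (e : ℕ)
    (y : FrobeniusRoot (invariantRing G) p e) : frobeniusRootVal p G e y ∈ invariantRing G :=
  Subtype.property (p := (· ∈ invariantRing G)) y

theorem coeff_sumToFrobeniusRoot {χ : Fin n → (diagGroup ζ t →* kˣ)}
    (hχ : ∀ β : Fin n, χ β (diagGen ζ t) = ζ ^ (β : ℕ)) {e : ℕ} (hp : (p ^ e).Coprime n)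
    (F : (β : Fin n) → BoxPoint n t (p ^ e) (p ^ e * β) → semiInvariants (diagGroup ζ t) (χ β))
    (β : Fin n) (b : BoxPoint n t (p ^ e) (p ^ e * β)) (a : Fin d →₀ ℕ) :
    coeff (boxExponent b.1 + p ^ e • a)
      (frobeniusRootVal p _ e (sumToFrobeniusRoot hζ t p hχ hp F)) =
        coeff a (F β b).1 ^ p ^ e := by
  have hval : frobeniusRootVal p _ e (sumToFrobeniusRoot hζ t p hχ hp F) =
      ∑ β, ∑ b : BoxPoint n t (p ^ e) (p ^ e * (β : Fin n)),
        monomial (boxExponent b.1) 1 * (F β b).1 ^ p ^ e := by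
    simp_rw [sumToFrobeniusRoot, LinearMap.sum_apply, map_sum]
    rfl
  rw [hval]
  simp_rw [map_sum, coeff_monomial_mul_pow_char_pow]
  rw [Finset.sum_eq_single β, Finset.sum_eq_single b, if_pos rfl]
  · intro b' _ hb'
    exact if_neg fun h => hb' (Subtype.ext h)
  · simp
  · intro β' _ hβ'
    refine Finset.sum_eq_zero fun b' _ => if_neg fun h => hβ' ?_
    have h1 := b'.2
    rw [h] at h1
    have h2 := Nat.ModEq.cancel_left_of_coprime hp.symm (h1.symm.trans b.2)
    exact Fin.ext (Nat.ModEq.eq_of_lt_of_lt h2 β'.2 β.2)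
  · simp

theorem exists_boxPoint {P : ℕ} (hn : 0 < n) (hP : P.Coprime n) (b : Fin d → Fin P) :
    ∃ β : Fin n, (∑ l, (b l : ℕ) * t l) ≡ P * β [MOD n] := by
  have : NeZero n := ⟨hn.ne'⟩
  let u := ZMod.unitOfCoprime P hP
  let x : ZMod n := (u⁻¹ : (ZMod n)ˣ) * ((∑ l, (b l : ℕ) * t l : ℕ) : ZMod n)
  refine ⟨⟨x.val, x.val_lt⟩, ?_⟩
  rw [← ZMod.natCast_eq_natCast_iff, Nat.cast_mul, ZMod.natCast_zmod_val]
  change _ = (u : ZMod n) * _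
  rw [Units.mul_inv_cancel_left]

theorem ext_of_boxPoint (hn : 0 < n) {e : ℕ} (hp : (p ^ e).Coprime n)
    {f g : MvPowerSeries (Fin d) k}
    (h : ∀ (β : Fin n) (b : BoxPoint n t (p ^ e) (p ^ e * β)) (a : Fin d →₀ ℕ),
      coeff (boxExponent b.1 + p ^ e • a) f = coeff (boxExponent b.1 + p ^ e • a) g) : f = g := by
  ext c
  obtain ⟨b, a, rfl⟩ := exists_eq_boxExponent_add (pow_pos (expChar_pos k p) e) c
  obtain ⟨β, hβ⟩ := exists_boxPoint t hn hp b
  exact h β ⟨b, hβ⟩ a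

theorem sumToFrobeniusRoot_bijective [PerfectRing k p] (hn : 0 < n)
    {χ : Fin n → (diagGroup ζ t →* kˣ)}
    (hχ : ∀ β : Fin n, χ β (diagGen ζ t) = ζ ^ (β : ℕ)) {e : ℕ} (hp : (p ^ e).Coprime n) :
    Function.Bijective (sumToFrobeniusRoot hζ t p hχ hp) := by
  constructor
  · intro F F' h
    funext β b
    refine Subtype.ext (MvPowerSeries.ext fun a => ?_)
    refine iterateFrobenius_inj k p e ?_
    rw [iterateFrobenius_def, iterateFrobenius_def, ← coeff_sumToFrobeniusRoot hζ t p hχ hp, h,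
      coeff_sumToFrobeniusRoot hζ t p hχ hp]
  · intro y
    let root : (Fin d → Fin (p ^ e)) → MvPowerSeries (Fin d) k := fun b a =>
      (iterateFrobeniusEquiv k p e).symm
        (coeff (boxExponent b + p ^ e • a) (frobeniusRootVal p _ e y))
    have hroot : ∀ (β : Fin n) (b : BoxPoint n t (p ^ e) (p ^ e * β)),
        root b.1 ∈ semiInvariants (diagGroup ζ t) (χ β) := by
      intro β b
      rw [mem_semiInvariants_iff hζ t (hχ β)]
      intro a ha
      rw [← dvd_weight_boxExponent_add_iff t hp b]
      refine (mem_invariantRing_iff hζ t _).1 (frobeniusRootVal_mem p _ e y) _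
        fun h => ha ?_
      exact (congrArg (iterateFrobeniusEquiv k p e).symm h).trans (map_zero _)
    let F : (β : Fin n) → BoxPoint n t (p ^ e) (p ^ e * β) →
        semiInvariants (diagGroup ζ t) (χ β) := fun β b => ⟨root b.1, hroot β b⟩
    refine ⟨F, Subtype.ext (ext_of_boxPoint t p hn hp fun β b a => ?_)⟩
    refine (coeff_sumToFrobeniusRoot hζ t p hχ hp F β b a).trans ?_
    exact (iterateFrobeniusEquiv k p e).apply_symm_apply _

end FrobeniusDecomposition

/-! ### Uniqueness of the multiplicities -/

section KrullSchmidt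

/-- Uniqueness of multiplicities: suppose that `κ` assigns a scalar to every homomorphism
between modules of a family, is additive and multiplicative, and kills the homomorphisms between
different members. Then direct sums of members of the family are isomorphic only if the
multiplicities agree, because an isomorphism gives mutually inverse matrices over `K`. -/
theorem multiplicity_eq_of_linearEquiv {A K ι : Type*} [Semiring A] [Field K] [Fintype ι]
    [DecidableEq ι] {M : ι → Type*} [∀ i, AddCommMonoid (M i)] [∀ i, Module A (M i)]
    (κ : ∀ i j, (M i →ₗ[A] M j) →+ K) (hid : ∀ i, κ i i LinearMap.id = 1)
    (hcomp : ∀ i j l (f : M i →ₗ[A] M j) (g : M j →ₗ[A] M l),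
      κ i l (g ∘ₗ f) = κ j l g * κ i j f)
    (hne : ∀ i j, i ≠ j → ∀ f, κ i j f = 0) {c c' : ι → ℕ}
    (E : ((i : ι) → Fin (c i) → M i) ≃ₗ[A] ((i : ι) → Fin (c' i) → M i)) : c = c' := by
  let inc : ∀ (c : ι → ℕ) (i : ι), Fin (c i) → (M i →ₗ[A] (i : ι) → Fin (c i) → M i) :=
    fun c i x => LinearMap.single A (fun i => Fin (c i) → M i) i ∘ₗ
      LinearMap.single A (fun _ => M i) x
  let pr : ∀ (c : ι → ℕ) (i : ι), Fin (c i) → (((i : ι) → Fin (c i) → M i) →ₗ[A] M i) :=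
    fun c i x => LinearMap.proj x ∘ₗ LinearMap.proj i
  have hsum : ∀ c : ι → ℕ, ∑ i, ∑ x, inc c i x ∘ₗ pr c i x = LinearMap.id := by
    intro c
    refine LinearMap.ext fun v => ?_
    funext j y
    simp only [LinearMap.sum_apply, Finset.sum_apply, LinearMap.comp_apply, inc, pr,
      LinearMap.proj_apply, LinearMap.id_apply, LinearMap.single_apply]
    rw [Finset.sum_eq_single j, Finset.sum_eq_single y]
    · simp
    · intro x _ hx
      simp [Pi.single_eq_of_ne hx.symm]
    · simp
    · intro i _ hi
      refine Finset.sum_eq_zero fun x _ => ?_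
      rw [Pi.single_eq_of_ne hi.symm]
      rfl
    · simp
  have hpi : ∀ (c : ι → ℕ) (i : ι) (x y : Fin (c i)),
      κ i i (pr c i x ∘ₗ inc c i y) = if x = y then 1 else 0 := by
    intro c i x y
    split_ifs with h
    · rw [← hid i, h]
      congr 1
      ext v
      simp [pr, inc]
    · rw [← map_zero (κ i i)]
      congr 1
      ext v
      simp [pr, inc, Pi.single_eq_of_ne h]
  -- The block at `i` of the matrix of scalars attached to a homomorphism of direct sums; blocks
  -- between different members of the family vanish by `hne`.
  let mat : ∀ (c c' : ι → ℕ) (f : ((i : ι) → Fin (c i) → M i) →ₗ[A] (i : ι) → Fin (c' i) → M i)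
      (i : ι), Matrix (Fin (c' i)) (Fin (c i)) K :=
    fun c c' f i => Matrix.of fun y x => κ i i (pr c' i y ∘ₗ f ∘ₗ inc c i x)
  have hmul : ∀ (c c' : ι → ℕ)
      (E : ((i : ι) → Fin (c i) → M i) ≃ₗ[A] ((i : ι) → Fin (c' i) → M i)) (i : ι),
      mat c' c E.symm.toLinearMap i * mat c c' E.toLinearMap i = 1 := by
    intro c c' E i
    ext x y
    rw [Matrix.mul_apply, Matrix.one_apply, ← hpi]
    have h1 : pr c i x ∘ₗ inc c i y = ∑ j, ∑ z,
        (pr c i x ∘ₗ E.symm.toLinearMap ∘ₗ inc c' j z) ∘ₗ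
          (pr c' j z ∘ₗ E.toLinearMap ∘ₗ inc c i y) := by
      have h2 : pr c i x ∘ₗ inc c i y =
          (pr c i x ∘ₗ E.symm.toLinearMap) ∘ₗ LinearMap.id ∘ₗ (E.toLinearMap ∘ₗ inc c i y) := by
        ext v
        simp
      rw [h2, ← hsum c']
      ext v
      simp only [LinearMap.comp_apply, LinearMap.sum_apply, map_sum]
    rw [h1, map_sum, Finset.sum_eq_single i, map_sum]
    · simp_rw [hcomp]
      rfl
    · intro j _ hj
      rw [map_sum]
      refine Finset.sum_eq_zero fun z _ => ?_
      rw [hcomp, hne j i hj, zero_mul]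
    · simp
  funext i
  have := (Matrix.toLin'OfInv (hmul c c' E i) (hmul c' c E.symm i)).finrank_eq
  simpa using this

end KrullSchmidt

section Multiplier

open MvPowerSeries

variable {k : Type u} [Field k] {d : ℕ} {n : ℕ} {ζ : kˣ} (hζ : IsPrimitiveRoot ζ n)
  (t : Fin d → ℕ)

theorem monomial_one_ne_zero (a : Fin d →₀ ℕ) : monomial a (1 : k) ≠ 0 := fun h => by
  have := congrArg (coeff a) h
  rw [coeff_monomial_same, map_zero] at this
  exact one_ne_zero this

/-- If the `t_l` with `l ∈ J` generate `ℤ/n`, monomials in the variables `x_l`, `l ∈ J`, take all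
weights modulo `n`. -/
theorem exists_dvd_add_weight (hn : 0 < n) {J : Finset (Fin d)} (hJ : gcdOn n t J = 1) (β : ℕ) :
    ∃ a : Fin d →₀ ℕ, (∀ l, l ∉ J → a l = 0) ∧ n ∣ β + weight t a := by
  have : NeZero n := ⟨hn.ne'⟩
  obtain ⟨c, hc⟩ := exists_sum_mul_eq_of_gcd_dvd n t J (s := -(β : ℤ))
    (by rw [show n.gcd (J.gcd t) = 1 from hJ]; exact one_dvd _)
  refine ⟨Finsupp.equivFunOnFinite.symm fun l => if l ∈ J then (c l).val else 0,
    fun l hl => by simp [hl], ?_⟩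
  rw [← ZMod.natCast_eq_zero_iff, Nat.cast_add, weight, Nat.cast_sum]
  have h : ∑ l, (((if l ∈ J then (c l).val else 0) * t l : ℕ) : ZMod n) =
      ∑ l ∈ J, c l * (t l : ZMod n) := by
    rw [← Finset.sum_filter_add_sum_filter_not Finset.univ (· ∈ J)]
    rw [Finset.sum_eq_zero (s := Finset.univ.filter (· ∉ J)), add_zero,
      Finset.filter_univ_mem]
    · refine Finset.sum_congr rfl fun l hl => ?_
      rw [if_pos hl, Nat.cast_mul, ZMod.natCast_zmod_val]
    · intro l hl
      simp [(Finset.mem_filter.1 hl).2]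
  have h2 := h.trans hc
  push_cast at h2 ⊢
  simp only [Finsupp.equivFunOnFinite_symm_apply_apply]
  push_cast
  rw [h2, add_neg_cancel]

variable {t}

include hζ

/-- Homomorphisms between modules of semi-invariants are given by multiplication with an element
of the fraction field of `S`. -/
theorem mul_map_comm (hn : 0 < n) (hg : gcdOn n t Finset.univ = 1)
    {χ χ' : diagGroup ζ t →* kˣ} {β : ℕ} (hχ : χ (diagGen ζ t) = ζ ^ β)
    (f : semiInvariants (diagGroup ζ t) χ →ₗ[invariantRing (diagGroup ζ t)]
      semiInvariants (diagGroup ζ t) χ') (u v : semiInvariants (diagGroup ζ t) χ) :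
    u.1 * (f v).1 = v.1 * (f u).1 := by
  -- A monomial `x^w` of weight `β` turns the semi-invariants `u` and `v` into invariants.
  obtain ⟨β', hβ'⟩ : ∃ β', n ∣ β + β' := ⟨n * β - β, by
    rw [Nat.add_sub_cancel' (Nat.le_mul_of_pos_left β hn)]; exact dvd_mul_right _ _⟩
  obtain ⟨w, -, hw⟩ := exists_dvd_add_weight t hn hg β'
  have hR : ∀ x : semiInvariants (diagGroup ζ t) χ,
      monomial w (1 : k) * x.1 ∈ invariantRing (diagGroup ζ t) := by
    intro x
    rw [mem_invariantRing_iff hζ]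
    intro c hc
    rw [coeff_monomial_mul] at hc
    obtain ⟨hwc, hc⟩ := ite_ne_right_iff.1 hc
    rw [one_mul] at hc
    have h1 := (mem_semiInvariants_iff hζ t hχ _).1 x.2 _ hc
    have h2 : n ∣ (β + β') + weight t c := by
      rw [← add_tsub_cancel_of_le hwc, weight_add, add_comm (weight t w), add_add_add_comm]
      exact dvd_add h1 hw
    exact (Nat.dvd_add_right hβ').1 h2
  have h : (⟨_, hR u⟩ : invariantRing (diagGroup ζ t)) • v =
      (⟨_, hR v⟩ : invariantRing (diagGroup ζ t)) • u :=
    Subtype.ext (show (_ * u.1) * v.1 = (_ * v.1) * u.1 by ring)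
  have h' := congrArg (fun x => (f x).1) h
  simp only [map_smul] at h'
  change (_ * u.1) * (f v).1 = (_ * v.1) * (f u).1 at h'
  rw [mul_assoc, mul_assoc] at h'
  exact mul_left_cancel₀ (monomial_one_ne_zero w) h'

/-- For a small group, homomorphisms between modules of semi-invariants are given by
multiplication with a power series `h`: a denominator could only be a monomial, and for every `i`
the module contains a monomial that does not involve `x_i`. -/
theorem exists_multiplier (hn : 0 < n) (hcard : Nat.card (diagGroup ζ t) = n)
    (hsmall : IsSmall (diagGroup ζ t))
    {χ χ' : diagGroup ζ t →* kˣ} {β : ℕ} (hχ : χ (diagGen ζ t) = ζ ^ β)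
    (f : semiInvariants (diagGroup ζ t) χ →ₗ[invariantRing (diagGroup ζ t)]
      semiInvariants (diagGroup ζ t) χ') :
    ∃ h : MvPowerSeries (Fin d) k, ∀ u, (f u).1 = u.1 * h := by
  have hg := gcdOn_univ_eq_one hζ t hn hcard
  have hcomm := mul_map_comm hζ hn hg hχ f
  obtain ⟨a, -, ha⟩ := exists_dvd_add_weight t hn hg β
  let u₀ : semiInvariants (diagGroup ζ t) χ := ⟨_, monomial_mem_semiInvariants hζ t hχ ha⟩
  have hdvd : ∀ c, coeff c (f u₀).1 ≠ 0 → a ≤ c := by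
    intro c hc i
    obtain ⟨b, hbi, hb⟩ := exists_dvd_add_weight t hn
      (gcdOn_erase_eq_one hζ t hn hcard hsmall i) β
    let v : semiInvariants (diagGroup ζ t) χ := ⟨_, monomial_mem_semiInvariants hζ t hχ hb⟩
    have h1 := congrArg (coeff (b + c)) (hcomm v u₀)
    rw [coeff_add_monomial_mul, one_mul, coeff_monomial_mul] at h1
    have h2 : a ≤ b + c := by
      by_contra hlt
      rw [if_neg hlt] at h1
      exact hc h1
    have h3 := h2 i
    rwa [Finsupp.add_apply, hbi i (Finset.notMem_erase i _), zero_add] at h3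
  let h : MvPowerSeries (Fin d) k := fun c => coeff (a + c) (f u₀).1
  have hu₀ : (f u₀).1 = u₀.1 * h := by
    ext c
    rw [coeff_monomial_mul]
    split_ifs with hac
    · change _ = 1 * coeff (a + (c - a)) (f u₀).1
      rw [add_tsub_cancel_of_le hac, one_mul]
    · by_contra hc
      exact hac (hdvd c hc)
  refine ⟨h, fun u => ?_⟩
  have h1 := hcomm u₀ u
  rw [hu₀, mul_left_comm] at h1
  exact mul_left_cancel₀ (monomial_one_ne_zero a) h1

/-- Direct sums of modules of semi-invariants of a small cyclic group are isomorphic only if the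
multiplicities agree. -/
theorem multiplicity_eq_of_semiInvariants_equiv (hn : 0 < n)
    (hcard : Nat.card (diagGroup ζ t) = n) (hsmall : IsSmall (diagGroup ζ t))
    {χ : Fin n → (diagGroup ζ t →* kˣ)}
    (hχ : ∀ β : Fin n, χ β (diagGen ζ t) = ζ ^ (β : ℕ)) {c c' : Fin n → ℕ}
    (E : ((β : Fin n) → Fin (c β) → semiInvariants (diagGroup ζ t) (χ β))
      ≃ₗ[invariantRing (diagGroup ζ t)]
        ((β : Fin n) → Fin (c' β) → semiInvariants (diagGroup ζ t) (χ β))) : c = c' := by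
  have hg := gcdOn_univ_eq_one hζ t hn hcard
  choose a ha using fun β : Fin n => exists_dvd_add_weight t hn hg β
  let x : ∀ β, semiInvariants (diagGroup ζ t) (χ β) := fun β =>
    ⟨_, monomial_mem_semiInvariants hζ t (hχ β) (ha β).2⟩
  -- `κ f` is the constant coefficient of the multiplier of `f`, read off from `f (x^a)`.
  let κ : ∀ β γ, (semiInvariants (diagGroup ζ t) (χ β) →ₗ[invariantRing (diagGroup ζ t)]
      semiInvariants (diagGroup ζ t) (χ γ)) →+ k := fun β γ =>
    { toFun := fun f => coeff (a β) (f (x β)).1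
      map_zero' := map_zero _
      map_add' := fun f g => map_add (coeff (a β)) _ _ }
  have hκ : ∀ β γ f (h : MvPowerSeries (Fin d) k), (∀ u, (f u).1 = u.1 * h) →
      κ β γ f = constantCoeff h := by
    intro β γ f h hf
    change coeff (a β) (f (x β)).1 = _
    rw [hf, ← coeff_zero_eq_constantCoeff_apply]
    conv_lhs => rw [← add_zero (a β)]
    rw [coeff_add_monomial_mul, one_mul]
  have hmul : ∀ β γ (f : semiInvariants (diagGroup ζ t) (χ β) →ₗ[invariantRing (diagGroup ζ t)]
      semiInvariants (diagGroup ζ t) (χ γ)), ∃ h : MvPowerSeries (Fin d) k,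
        ∀ u, (f u).1 = u.1 * h :=
    fun β γ f => exists_multiplier hζ hn hcard hsmall (hχ β) f
  refine multiplicity_eq_of_linearEquiv κ (fun β => ?_) (fun β γ δ f g => ?_)
    (fun β γ hne f => ?_) E
  · rw [hκ β β _ 1 (fun u => (mul_one u.1).symm), map_one]
  · obtain ⟨h, hh⟩ := hmul β γ f
    obtain ⟨h', hh'⟩ := hmul γ δ g
    rw [hκ β γ f h hh, hκ γ δ g h' hh', hκ β δ _ (h * h'), map_mul, mul_comm]
    intro u
    rw [LinearMap.comp_apply, hh', hh, mul_assoc]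
  · by_contra hc
    have h1 := (mem_semiInvariants_iff hζ t (hχ γ) _).1 (f (x β)).2 (a β) hc
    have h2 : (β : ℕ) ≡ γ [MOD n] := by
      refine Nat.ModEq.add_right_cancel' (weight t (a β)) ?_
      exact ((Nat.modEq_zero_iff_dvd).2 (ha β).2).trans ((Nat.modEq_zero_iff_dvd).2 h1).symm
    exact hne (Fin.ext (Nat.ModEq.eq_of_lt_of_lt h2 β.2 γ.2))

end Multiplier

/-! ### Characters and multiplicities -/

section Main

variable {k : Type u} [Field k] {d : ℕ} {n : ℕ} {ζ : kˣ} (hζ : IsPrimitiveRoot ζ n)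
  (t : Fin d → ℕ)

include hζ

/-- The characters of the cyclic group `G` of order `n` are `V_0, …, V_{n-1}`, where `V_β` takes
the value `ζ^β` on the generator. -/
theorem exists_characterEquiv (hn : 0 < n) (hcard : Nat.card (diagGroup ζ t) = n) :
    ∃ V : Fin n ≃ (diagGroup ζ t →* kˣ), ∀ β : Fin n, V β (diagGen ζ t) = ζ ^ (β : ℕ) := by
  have hgen : ∀ x, x ∈ Subgroup.zpowers (diagGen ζ t) := by
    rintro ⟨x, hx⟩
    obtain ⟨j, rfl⟩ := Subgroup.mem_zpowers_iff.1 hx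
    exact Subgroup.mem_zpowers_iff.2 ⟨j, Subtype.ext rfl⟩
  have hord : orderOf (diagGen ζ t) = n := by
    rw [← hcard]
    exact orderOf_eq_card_of_forall_mem_zpowers hgen
  have hdvd : ∀ β : Fin n, orderOf (ζ ^ (β : ℕ)) ∣ orderOf (diagGen ζ t) := fun β => by
    rw [hord]
    exact orderOf_dvd_of_pow_eq_one (by rw [← pow_mul, mul_comm, pow_mul, hζ.pow_eq_one, one_pow])
  let V : Fin n → (diagGroup ζ t →* kˣ) := fun β => monoidHomOfForallMemZpowers hgen (hdvd β)
  have hV : ∀ β, V β (diagGen ζ t) = ζ ^ (β : ℕ) := fun β =>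
    monoidHomOfForallMemZpowers_apply_gen hgen (hdvd β)
  refine ⟨Equiv.ofBijective V ⟨fun β γ h => ?_, fun χ => ?_⟩, hV⟩
  · have h1 := congrArg (fun χ => χ (diagGen ζ t)) h
    simp only [hV] at h1
    exact Fin.ext (hζ.pow_inj β.2 γ.2 h1)
  · have : NeZero n := ⟨hn.ne'⟩
    have h1 : χ (diagGen ζ t) ^ n = 1 := by rw [← map_pow, ← hord, pow_orderOf_eq_one, map_one]
    obtain ⟨i, hi, h2⟩ := (IsPrimitiveRoot.coe_units_iff.2 hζ).eq_pow_of_pow_eq_one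
      (ξ := (χ (diagGen ζ t) : k)) (by rw [← Units.val_pow_eq_pow_val, h1, Units.val_one])
    refine ⟨⟨i, hi⟩, MonoidHom.ext fun x => ?_⟩
    obtain ⟨j, rfl⟩ := Subgroup.mem_zpowers_iff.1 (hgen x)
    rw [map_zpow, map_zpow, hV]
    congr 1
    exact Units.ext (by rw [← h2, Units.val_pow_eq_pow_val])

/-- The decomposition `R^{1/p^e} ≅ ⨁_β M_β^{m_β}`, where `m_β` is the number of points `b` of the
box `[0, p^e)^d` with `∑ b_l t_l ≡ p^e β` modulo `n`. -/
theorem nonempty_frobeniusRoot_equiv (hn : 0 < n) (p : ℕ) [ExpChar k p] [PerfectRing k p]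
    {χ : Fin n → (diagGroup ζ t →* kˣ)}
    (hχ : ∀ β : Fin n, χ β (diagGen ζ t) = ζ ^ (β : ℕ)) {e : ℕ} (hp : (p ^ e).Coprime n) :
    Nonempty (FrobeniusRoot (invariantRing (diagGroup ζ t)) p e
      ≃ₗ[invariantRing (diagGroup ζ t)]
        ((β : Fin n) → Fin (Nat.card (BoxPoint n t (p ^ e) (p ^ e * β))) →
          semiInvariants (diagGroup ζ t) (χ β))) :=
  ⟨(LinearEquiv.ofBijective _ (sumToFrobeniusRoot_bijective hζ t p hn hχ hp)).symm.trans <|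
    LinearEquiv.piCongrRight fun _ => LinearEquiv.funCongrLeft _ _ (Finite.equivFin _).symm⟩

end Main

end QuotientSingularity

end

open QuotientSingularity

theorem theorem4p9 {k : Type*} [Field k] [IsAlgClosed k] {p : ℕ} [Fact p.Prime] [CharP k p]
    {d n : ℕ} (hn : 1 < n) (hpn : ¬ p ∣ n)
    (ζ : kˣ) (hζ : IsPrimitiveRoot ζ n) (t : Fin d → ℕ)
    (hcard : Nat.card (diagGroup ζ t) = n) (hsmall : IsSmall (diagGroup ζ t)) :
    -- the irreducible representations `V_0, …, V_{n-1}`: the generator acts on `V_β` by `ζ^β`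
    ∃ V : Fin n ≃ (diagGroup ζ t →* kˣ),
      (∀ β : Fin n, V β (diagGen ζ t) = ζ ^ (β : ℕ)) ∧
      -- `m β e` is the multiplicity of `M_β = (S ⊗ V_β)^G` in `R^{1/p^e}`
      ∃ m : Fin n → ℕ → ℕ,
        (∀ (e : ℕ) (c : Fin n → ℕ),
          Nonempty (FrobeniusRoot (invariantRing (diagGroup ζ t)) p e
            ≃ₗ[invariantRing (diagGroup ζ t)]
              ((β : Fin n) → Fin (c β) →
                covariants (diagGroup ζ t) (charRep (diagGroup ζ t) (V β)))) ↔
            ∀ β, c β = m β e) ∧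
        -- `M_α` labelled, for every `e`, so that the generator acts on the corresponding
        -- representation by `(ζ^{1/p^e})^α`
        (∀ (α : Fin n) (β : ℕ → Fin n),
          (∀ e, V (β e) (diagGen ζ t) ^ p ^ e = ζ ^ (α : ℕ)) →
          ∀ φ : Fin (d + 1) → ℕ → ℚ,
            IsQuasiPolynomialCoeff p d (fun e => m (β e) e) φ ↔
              ∀ c e, φ c e = coeffFormula p n t α c e) ∧
        -- the same for a module `M_β` that does not change with `e`
        (∀ (β : Fin n) (φ : Fin (d + 1) → ℕ → ℚ),
          IsQuasiPolynomialCoeff p d (m β) φ ↔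
            ∀ c e, φ c e = coeffFormula p n t (p ^ e * (β : ℕ) % n) c e) := by
  classical
  have hn0 : 0 < n := zero_lt_one.trans hn
  have hp : p.Prime := Fact.out
  have hcop : p.Coprime n := hp.coprime_iff_not_dvd.2 hpn
  have hg := gcdOn_univ_eq_one hζ t hn0 hcard
  obtain ⟨V, hV⟩ := exists_characterEquiv hζ t hn0 hcard
  let m : Fin n → ℕ → ℕ := fun β e => Nat.card (BoxPoint n t (p ^ e) (p ^ e * β))
  refine ⟨V, hV, m, fun e c => ?_, fun α β hβ φ => ?_, fun β φ => ?_⟩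
  · obtain ⟨E₀⟩ := nonempty_frobeniusRoot_equiv hζ t hn0 p hV (hcop.pow_left e)
    have E₁ : ∀ c : Fin n → ℕ,
        ((β : Fin n) → Fin (c β) → covariants (diagGroup ζ t) (charRep (diagGroup ζ t) (V β)))
          ≃ₗ[invariantRing (diagGroup ζ t)]
            ((β : Fin n) → Fin (c β) → semiInvariants (diagGroup ζ t) (V β)) := fun c =>
      LinearEquiv.piCongrRight fun _ => LinearEquiv.piCongrRight fun _ => covariantsEquiv _ _
    constructor
    · rintro ⟨E⟩ β
      exact congrFun (multiplicity_eq_of_semiInvariants_equiv hζ hn0 hcard hsmall hV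
        ((E₁ c).symm.trans (E.symm.trans E₀))) β
    · intro h
      obtain rfl : c = fun β => m β e := funext h
      exact ⟨E₀.trans (E₁ _).symm⟩
  · refine isQuasiPolynomialCoeff_iff hp.one_lt hn0 hcop t hg (fun _ => α) (fun _ => rfl)
      (fun e => Nat.card_congr (Equiv.subtypeEquivRight fun b => ?_)) φ
    have h1 : p ^ e * (β e : ℕ) ≡ α [MOD n] := by
      have h2 := hβ e
      rw [hV, ← pow_mul, mul_comm] at h2
      have h3 := pow_eq_pow_iff_modEq.1 h2
      rwa [← hζ.eq_orderOf] at h3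
    exact ⟨fun h => h.trans h1, fun h => h.trans h1.symm⟩
  · refine isQuasiPolynomialCoeff_iff hp.one_lt hn0 hcop t hg (fun e => p ^ e * (β : ℕ) % n)
      (fun e => ?_) (fun e => Nat.card_congr (Equiv.subtypeEquivRight fun b => ?_)) φ
    · have h : p ^ (e + n.totient) ≡ p ^ e [MOD n] := remainder_add_totient hcop e
      exact h.mul_right _
    · have h := Nat.mod_modEq (p ^ e * (β : ℕ)) n
      exact ⟨fun h' => h'.trans h.symm, fun h' => h'.trans h⟩
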